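/- Words are over finite alphabets. A \emph{nondeterministic two-way $k$-head finite automaton} $M$ consists of a finite set $S$ of states, a finite input alphabet $A$, an initial state $s_0\in S$, a set $F\subseteq S$ of accepting states, endmarkers $\vartriangleright,\vartriangleleft\notin A$, and a partial transition function $\delta$ from $S\times(A\cup\{\vartriangleright,\vartriangleleft\})^k$ to subsets of $S\times\{-1,0,1\}^k$ such that no head moves left on $\vartriangleright$ or right on $\vartriangleleft$ (the empty set of choices counts as "undefined"). On input $w=a_1\cdots a_n\in A^*$ the tape holds $\vartriangleright w\vartriangleleft$ on squares $0,\dots,n+1$, and $M$ starts in state $s_0$ with all heads on square $1$. If it is in state $s$ with the heads scanning symbols $b_1,\dots,b_k$, it chooses some $(s',(d_1,\dots,d_k))\in\delta(s,(b_1,\dots,b_k))$, enters state $s'$, and moves head $i$ by $d_i$; it halts when $\delta$ is undefined. $M$ accepts $w\in A^*$ if some computation halts in a state of $F$. $M$ is \emph{deterministic} if $\delta$ is always undefined or a singleton, and \emph{one-way} if no head ever moves to the left. Let $1\mathrm{DFA}(k)$, $1\mathrm{NFA}(k)$, $2\mathrm{DFA}(k)$, $2\mathrm{NFA}(k)$ denote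 the deterministic/nondeterministic one-way/two-way $k$-head finite automata. A \emph{language family} $\mathcal F$ is given by a recursive set of finite descriptors $D$, each describing a formal language $L(D)$. Its word problem is \emph{semi-decidable} if it is semi-decidable, given a descriptor $D$ and a word $w$, whether $w\in L(D)$. It \emph{effectively contains} the family of languages accepted by a type of automata if some computable procedure turns each automaton $M$ of that type into a descriptor $D$ of $\mathcal F$ with $L(D)=L(M)$. It \emph{possesses a pumping lemma} if there is a computable function assigning to each descriptor $D$ a constant $n(D)\in\mathbb N$ such that each word $z\in L(D)$ with $|z|>n(D)$ has a factorization $z=uvx$ with $|v|\ge 1$ for which $u'v^ix'\in L(D)$ for infinitely many $i\ge 0$, where the words $u'$ and $x'$ may depend on $u$, $x$ and $i$. \textbf{Theorem.} Let $k\ge 2$. Then any language family whose word problem is semi-decidable and which effectively contains the family of languages accepted by $1\mathrm{DFA}(k)$, or by $1\mathrm{NFA}(k)$, or by $2\mathrm{DFA}(k)$, or by $2\mathrm{NFA}(k)$, does not possess a pumping lemma. -/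

import Mathlib

/-! ### Multi-head finite automata, as finite (hence codable) objects -/

/-- The symbols on a tape with inscription `▷ w ◁`; letters are natural numbers. -/
inductive TapeSymbol where
  | leftEnd : TapeSymbol
  | rightEnd : TapeSymbol
  | letter : ℕ → TapeSymbol
  deriving DecidableEq

namespace TapeSymbol

def equivOption : TapeSymbol ≃ Option (Option ℕ) where
  toFun
    | leftEnd => none
    | rightEnd => some none
    | letter a => some (some a)
  invFun
    | none => leftEnd
    | some none => rightEnd
    | some (some a) => letter a
  left_inv x := by cases x <;> rfl
  right_inv x := by rcases x with _ | _ | _ <;> rfl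

instance : Primcodable TapeSymbol := Primcodable.ofEquiv _ equivOption

end TapeSymbol

/-- The possible movements of a head in one step. -/
inductive HeadMove where
  | left : HeadMove
  | stay : HeadMove
  | right : HeadMove
  deriving DecidableEq

namespace HeadMove

def toInt : HeadMove → ℤ
  | left => -1
  | stay => 0
  | right => 1

def equivFin : HeadMove ≃ Fin 3 where
  toFun
    | left => 0
    | stay => 1
    | right => 2
  invFun i := if i = 0 then left else if i = 1 then stay else right
  left_inv x := by cases x <;> rfl
  right_inv x := by fin_cases x <;> rfl

instance : Primcodable HeadMove := Primcodable.ofEquiv _ equivFin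

end HeadMove

/-- The data of a `k`-head finite automaton. The lists `states`, `alphabet` and `accepting` stand
for finite sets; the states and the letters are natural numbers. The list `trans` is the graph of
the transition function: `((s, a), (s', d)) ∈ trans` means `(s', d) ∈ δ (s, a)`, and `δ (s, a)` is
undefined if no such pair occurs. The conditions on these data are in `IsAutomaton`. -/
structure MultiHeadAutomaton (k : ℕ) where
  states : List ℕ
  alphabet : List ℕ
  trans : List ((ℕ × (Fin k → TapeSymbol)) × (ℕ × (Fin k → HeadMove)))
  start : ℕ
  accepting : List ℕ

namespace MultiHeadAutomaton

variable {k : ℕ}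

def equivProd : MultiHeadAutomaton k ≃
    (List ℕ × List ℕ × List ((ℕ × (Fin k → TapeSymbol)) × (ℕ × (Fin k → HeadMove))) ×
      ℕ × List ℕ) where
  toFun M := (M.states, M.alphabet, M.trans, M.start, M.accepting)
  invFun t := ⟨t.1, t.2.1, t.2.2.1, t.2.2.2.1, t.2.2.2.2⟩
  left_inv _ := rfl
  right_inv _ := rfl

instance : Primcodable (MultiHeadAutomaton k) := Primcodable.ofEquiv _ equivProd

/-- `x` belongs to the set consisting of the input alphabet and the two endmarkers. -/
def IsTapeSymbol (M : MultiHeadAutomaton k) (x : TapeSymbol) : Prop :=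
  x = .leftEnd ∨ x = .rightEnd ∨ x ∈ M.alphabet.map TapeSymbol.letter

/-- The data form a nondeterministic two-way `k`-head finite automaton: the initial and the
accepting states are states, the transition function is defined on and takes values in the right
sets, and no head moves beyond an endmarker. -/
def IsAutomaton (M : MultiHeadAutomaton k) : Prop :=
  M.start ∈ M.states ∧ (∀ s ∈ M.accepting, s ∈ M.states) ∧
    ∀ t ∈ M.trans, (t.1.1 ∈ M.states ∧ t.2.1 ∈ M.states) ∧ ∀ i : Fin k,
      M.IsTapeSymbol (t.1.2 i) ∧
      (t.1.2 i = .leftEnd → t.2.2 i ≠ .left) ∧ (t.1.2 i = .rightEnd → t.2.2 i ≠ .right)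

/-- The transition function is everywhere undefined or a singleton. -/
def IsDeterministic (M : MultiHeadAutomaton k) : Prop :=
  ∀ t ∈ M.trans, ∀ t' ∈ M.trans, t.1 = t'.1 → t.2 = t'.2

/-- No head ever moves to the left. -/
def IsOneWay (M : MultiHeadAutomaton k) : Prop :=
  ∀ t ∈ M.trans, ∀ i : Fin k, t.2.2 i ≠ .left

/-- The symbol on square `p` of the tape `▷ w ◁`, where `▷` is on square `0`. -/
def scan (w : List ℕ) : ℕ → TapeSymbol
  | 0 => .leftEnd
  | p + 1 => match w[p]? with
    | some a => .letter a
    | none => .rightEnd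

/-- The current state and the current head positions (the input word is kept separate). -/
abbrev Config (k : ℕ) : Type := ℕ × (Fin k → ℕ)

/-- One computation step on input `w`. -/
def Step (M : MultiHeadAutomaton k) (w : List ℕ) (c c' : Config k) : Prop :=
  ∃ d : Fin k → HeadMove, ((c.1, fun i => scan w (c.2 i)), (c'.1, d)) ∈ M.trans ∧
    ∀ i, (c'.2 i : ℤ) = (c.2 i : ℤ) + (d i).toInt

/-- `M` halts in configuration `c`: the transition function is undefined there. -/
def Halts (M : MultiHeadAutomaton k) (w : List ℕ) (c : Config k) : Prop :=
  ∀ y, ((c.1, fun i => scan w (c.2 i)), y) ∉ M.trans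

/-- The language accepted by `M`: the words over its input alphabet on which some computation,
started with all heads on square `1`, halts in an accepting state. -/
def accepts (M : MultiHeadAutomaton k) : Language ℕ :=
  {w | (∀ a ∈ w, a ∈ M.alphabet) ∧ ∃ c : Config k,
    Relation.ReflTransGen (M.Step w) (M.start, fun _ => 1) c ∧ c.1 ∈ M.accepting ∧ M.Halts w c}

end MultiHeadAutomaton

/-! ### Language families given by descriptors -/

/-- A language family given by a recursive set of finite descriptors, each of which describes a
formal language over some finite alphabet; the letters are natural numbers. -/
structure LanguageFamily (α : Type*) [Primcodable α] where
  descriptors : Set α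
  recursive : ComputablePred fun D => D ∈ descriptors
  lang : α → Language ℕ
  finite_alphabet : ∀ D ∈ descriptors, ∃ A : Finset ℕ, ∀ w ∈ lang D, ∀ a ∈ w, a ∈ A

namespace LanguageFamily

variable {α β : Type*} [Primcodable α] [Primcodable β]

/-- Given a descriptor `D` and a word `w`, it is semi-decidable whether `w` is in the language
described by `D`. -/
def SemiDecidableWordProblem (E : LanguageFamily α) : Prop :=
  REPred fun p : α × List ℕ => p.1 ∈ E.descriptors ∧ p.2 ∈ E.lang p.1

/-- There is an effective procedure which converts every descriptor of `E'` into a descriptor of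
`E` for the same language. -/
def EffectivelyContains (E : LanguageFamily α) (E' : LanguageFamily β) : Prop :=
  ∃ g : β → α, Computable g ∧
    ∀ D ∈ E'.descriptors, g D ∈ E.descriptors ∧ E.lang (g D) = E'.lang D

/-- The word `z` is pumpable in `L`: it has a factorization `z = u v x` with `v` non-empty such
that `u' vⁱ x' ∈ L` for infinitely many `i`, where `u'` and `x'` may depend on `u`, `x` and `i`. -/
def IsPumpable (L : Language ℕ) (z : List ℕ) : Prop :=
  ∃ u v x : List ℕ, z = u ++ v ++ x ∧ 1 ≤ v.length ∧
    {i : ℕ | ∃ u' x' : List ℕ, u' ++ (List.replicate i v).flatten ++ x' ∈ L}.Infinite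

/-- The family possesses a pumping lemma: for every language `L` of the family there is a constant
`n`, computable from a descriptor of `L`, such that each word of `L` that is longer than `n` is
pumpable in `L`. -/
def PossessesPumpingLemma (E : LanguageFamily α) : Prop :=
  ∃ n : α → ℕ, Computable n ∧
    ∀ D ∈ E.descriptors, ∀ z ∈ E.lang D, n D < z.length → IsPumpable (E.lang D) z

end LanguageFamily

/-! ### The families of languages accepted by multi-head finite automata -/

namespace MultiHeadAutomaton

variable {k : ℕ}

theorem primrec_equivProd : Primrec (equivProd (k := k)) := Primrec.of_equiv

theorem primrec_states : Primrec (states (k := k)) :=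
  Primrec.fst.comp primrec_equivProd

theorem primrec_alphabet : Primrec (alphabet (k := k)) :=
  Primrec.fst.comp (Primrec.snd.comp primrec_equivProd)

theorem primrec_trans : Primrec (trans (k := k)) :=
  Primrec.fst.comp (Primrec.snd.comp (Primrec.snd.comp primrec_equivProd))

theorem primrec_start : Primrec (start (k := k)) :=
  Primrec.fst.comp (Primrec.snd.comp (Primrec.snd.comp (Primrec.snd.comp primrec_equivProd)))

theorem primrec_accepting : Primrec (accepting (k := k)) :=
  Primrec.snd.comp (Primrec.snd.comp (Primrec.snd.comp (Primrec.snd.comp primrec_equivProd)))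

theorem primrec_letter : Primrec TapeSymbol.letter :=
  (Primrec.of_equiv_symm (e := TapeSymbol.equivOption)).comp
    (Primrec.option_some.comp Primrec.option_some)

theorem primrecRel_mem {γ : Type*} [Primcodable γ] :
    PrimrecRel fun (l : List γ) (a : γ) => a ∈ l := by
  refine PrimrecRel.of_eq (PrimrecRel.exists_mem_list (R := fun a b : γ => a = b) Primrec.eq) ?_
  intro l a
  simp

theorem primrecPred_forall_fin {γ : Type*} [Primcodable γ] {p : Fin k → γ → Prop}
    (hp : ∀ i, PrimrecPred (p i)) : PrimrecPred fun a => ∀ i, p i a := by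
  have h : ∀ l : List (Fin k), PrimrecPred fun a => ∀ i ∈ l, p i a := by
    intro l
    induction l with
    | nil =>
      refine PrimrecPred.of_eq (p := fun a : γ => a = a) (Primrec.eq.comp .id .id) ?_
      simp
    | cons i l ih =>
      refine PrimrecPred.of_eq ((hp i).and ih) ?_
      simp
  refine PrimrecPred.of_eq (h (List.finRange k)) ?_
  simp

theorem primrecPred_forall_mem {γ δ : Type*} [Primcodable γ] [Primcodable δ] {l : γ → List δ}
    {p : δ → γ → Prop} (hl : Primrec l) (hp : PrimrecRel p) :
    PrimrecPred fun a => ∀ b ∈ l a, p b a :=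
  PrimrecRel.comp (PrimrecRel.forall_mem_list hp) hl .id

theorem primrecPred_isAutomaton :
    PrimrecPred fun M : MultiHeadAutomaton k => M.IsAutomaton := by
  unfold IsAutomaton IsTapeSymbol
  have h1 : Primrec fun p : ((ℕ × (Fin k → TapeSymbol)) × (ℕ × (Fin k → HeadMove))) ×
      MultiHeadAutomaton k => p.2.states := primrec_states.comp .snd
  have h2 : Primrec fun p : ((ℕ × (Fin k → TapeSymbol)) × (ℕ × (Fin k → HeadMove))) ×
      MultiHeadAutomaton k => p.2.alphabet.map TapeSymbol.letter :=
    Primrec.list_map (primrec_alphabet.comp .snd) (primrec_letter.comp .snd)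
  have h3 : ∀ i, Primrec fun p : ((ℕ × (Fin k → TapeSymbol)) × (ℕ × (Fin k → HeadMove))) ×
      MultiHeadAutomaton k => p.1.1.2 i := fun i =>
    Primrec.fin_app.comp (Primrec.snd.comp (Primrec.fst.comp .fst)) (.const i)
  have h4 : ∀ i, Primrec fun p : ((ℕ × (Fin k → TapeSymbol)) × (ℕ × (Fin k → HeadMove))) ×
      MultiHeadAutomaton k => p.1.2.2 i := fun i =>
    Primrec.fin_app.comp (Primrec.snd.comp (Primrec.snd.comp .fst)) (.const i)
  refine (PrimrecRel.comp primrecRel_mem primrec_states primrec_start).and (.and ?_ ?_)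
  · exact primrecPred_forall_mem primrec_accepting
      (PrimrecRel.comp primrecRel_mem (primrec_states.comp .snd) .fst)
  · refine primrecPred_forall_mem primrec_trans ?_
    refine PrimrecPred.and (.and ?_ ?_) (primrecPred_forall_fin fun i => .and (.or ?_ (.or ?_ ?_))
      (.and ?_ ?_))
    · exact PrimrecRel.comp primrecRel_mem h1 (Primrec.fst.comp (Primrec.fst.comp .fst))
    · exact PrimrecRel.comp primrecRel_mem h1 (Primrec.fst.comp (Primrec.snd.comp .fst))
    · exact Primrec.eq.comp (h3 i) (.const _)
    · exact Primrec.eq.comp (h3 i) (.const _)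
    · exact PrimrecRel.comp primrecRel_mem h2 (h3 i)
    · simp only [imp_iff_not_or]
      exact (Primrec.eq.comp (h3 i) (.const _)).not.or (Primrec.eq.comp (h4 i) (.const _)).not
    · simp only [imp_iff_not_or]
      exact (Primrec.eq.comp (h3 i) (.const _)).not.or (Primrec.eq.comp (h4 i) (.const _)).not

theorem primrecPred_isOneWay :
    PrimrecPred fun M : MultiHeadAutomaton k => M.IsOneWay :=
  primrecPred_forall_mem primrec_trans <| primrecPred_forall_fin fun i =>
    (Primrec.eq.comp (Primrec.fin_app.comp (Primrec.snd.comp (Primrec.snd.comp .fst)) (.const i))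
      (.const _)).not

theorem primrecPred_isDeterministic :
    PrimrecPred fun M : MultiHeadAutomaton k => M.IsDeterministic := by
  refine primrecPred_forall_mem primrec_trans ?_
  refine primrecPred_forall_mem (p := fun (t' : (ℕ × (Fin k → TapeSymbol)) × (ℕ × (Fin k → HeadMove)))
      (p : ((ℕ × (Fin k → TapeSymbol)) × (ℕ × (Fin k → HeadMove))) × MultiHeadAutomaton k) =>
      p.1.1 = t'.1 → p.1.2 = t'.2) (primrec_trans.comp .snd) ?_
  unfold PrimrecRel
  simp only [imp_iff_not_or]
  exact (Primrec.eq.comp (Primrec.fst.comp (Primrec.fst.comp .snd)) (Primrec.fst.comp .fst)).not.or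
    (Primrec.eq.comp (Primrec.snd.comp (Primrec.fst.comp .snd)) (Primrec.snd.comp .fst))

theorem accepts_finite_alphabet (M : MultiHeadAutomaton k) :
    ∃ A : Finset ℕ, ∀ w ∈ M.accepts, ∀ a ∈ w, a ∈ A :=
  ⟨M.alphabet.toFinset, fun _ hw a ha => List.mem_toFinset.2 (hw.1 a ha)⟩

/-- Nondeterministic two-way `k`-head finite automata. -/
def twoWayNFA (k : ℕ) : LanguageFamily (MultiHeadAutomaton k) where
  descriptors := {M | M.IsAutomaton}
  recursive := primrecPred_isAutomaton.computablePred
  lang := accepts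
  finite_alphabet M _ := M.accepts_finite_alphabet

/-- Deterministic two-way `k`-head finite automata. -/
def twoWayDFA (k : ℕ) : LanguageFamily (MultiHeadAutomaton k) where
  descriptors := {M | M.IsAutomaton ∧ M.IsDeterministic}
  recursive := (primrecPred_isAutomaton.and primrecPred_isDeterministic).computablePred
  lang := accepts
  finite_alphabet M _ := M.accepts_finite_alphabet

/-- Nondeterministic one-way `k`-head finite automata. -/
def oneWayNFA (k : ℕ) : LanguageFamily (MultiHeadAutomaton k) where
  descriptors := {M | M.IsAutomaton ∧ M.IsOneWay}
  recursive := (primrecPred_isAutomaton.and primrecPred_isOneWay).computablePred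
  lang := accepts
  finite_alphabet M _ := M.accepts_finite_alphabet

/-- Deterministic one-way `k`-head finite automata. -/
def oneWayDFA (k : ℕ) : LanguageFamily (MultiHeadAutomaton k) where
  descriptors := {M | M.IsAutomaton ∧ M.IsOneWay ∧ M.IsDeterministic}
  recursive := (primrecPred_isAutomaton.and
    (primrecPred_isOneWay.and primrecPred_isDeterministic)).computablePred
  lang := accepts
  finite_alphabet M _ := M.accepts_finite_alphabet

end MultiHeadAutomaton

/-- A deterministic queue machine: in state `q` with `a` at the front of the queue,
`δ q a = some (q', c, b)` means that it enters state `q'`, appends `c` to the queue, and removes `a`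
if `b` is true. -/
abbrev QueueMachine (Q Γ : Type*) : Type _ := Q → Γ → Option (Q × Γ × Bool)

namespace QueueMachine

open StateTransition

variable {Q Γ : Type*} (δ : QueueMachine Q Γ)

/-- One step on a state and a queue. -/
def step : Q × List Γ → Option (Q × List Γ)
  | (_, []) => none
  | (q, a :: l) => (δ q a).map fun r => (r.1, (if r.2.2 then l else a :: l) ++ [r.2.1])

/-- One step on a state, the number of symbols removed so far, and the word of all symbols that have
been in the queue so far. -/
def historyStep (c : Q × ℕ × List Γ) : Option (Q × ℕ × List Γ) :=
  c.2.2[c.2.1]?.bind fun a =>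
    (δ c.1 a).map fun r => (r.1, (if r.2.2 then c.2.1 + 1 else c.2.1), c.2.2 ++ [r.2.1])

theorem historyStep_eq_some {c c' : Q × ℕ × List Γ} :
    historyStep δ c = some c' ↔ ∃ a r, c.2.2[c.2.1]? = some a ∧ δ c.1 a = some r ∧
      c' = (r.1, (if r.2.2 then c.2.1 + 1 else c.2.1), c.2.2 ++ [r.2.1]) := by
  simp only [historyStep, Option.bind_eq_some_iff, Option.map_eq_some_iff]
  constructor
  · rintro ⟨a, ha, r, hr, rfl⟩
    exact ⟨a, r, ha, hr, rfl⟩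
  · rintro ⟨a, r, ha, hr, rfl⟩
    exact ⟨a, ha, r, hr, rfl⟩

theorem historyStep_respects :
    Respects (historyStep δ) (step δ) fun c d => (c.1, c.2.2.drop c.2.1) = d := by
  refine fun_respects.2 ?_
  rintro ⟨q, i, s⟩
  rcases hs : s[i]? with _ | a
  · have hd : s.drop i = [] := List.drop_eq_nil_of_le (List.getElem?_eq_none_iff.1 hs)
    simp [historyStep, hs, FRespects, hd, step]
  · obtain ⟨hi, ha⟩ := List.getElem?_eq_some_iff.1 hs
    have hd : s.drop i = a :: s.drop (i + 1) := by rw [List.drop_eq_getElem_cons hi, ha]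
    rcases hr : δ q a with _ | ⟨q', c, b⟩
    · simp [historyStep, hs, hr, FRespects, hd, step]
    · simp only [historyStep, hs, hr, FRespects, Option.bind_some, Option.map_some]
      refine Relation.TransGen.single ?_
      cases b
      · simp [hd, step, hr, List.drop_append_of_le_length hi.le]
      · simp [hd, step, hr, List.drop_append_of_le_length (Nat.succ_le_of_lt hi)]

theorem eval_historyStep_dom (q : Q) (s : List Γ) :
    (eval (historyStep δ) (q, 0, s)).Dom ↔ (eval (step δ) (q, s)).Dom :=
  (tr_eval_dom (historyStep_respects δ) (a₁ := (q, 0, s)) (a₂ := (q, s)) (by simp)).symm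

variable {δ}

theorem prefix_of_reaches {c c' : Q × ℕ × List Γ} (h : Reaches (historyStep δ) c c') :
    c.2.2 <+: c'.2.2 := by
  induction h with
  | refl => exact List.prefix_rfl
  | tail _ h ih =>
    obtain ⟨a, r, -, -, rfl⟩ := (historyStep_eq_some δ).1 h
    exact ih.trans (List.prefix_append _ _)

theorem removed_lt_length_of_reaches {c c' : Q × ℕ × List Γ} (h : Reaches (historyStep δ) c c')
    (hc : c.2.1 < c.2.2.length) : c'.2.1 < c'.2.2.length := by
  induction h with
  | refl => exact hc
  | tail _ h ih =>
    obtain ⟨a, r, -, -, rfl⟩ := (historyStep_eq_some δ).1 h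
    simp only [List.length_append, List.length_singleton]
    split_ifs <;> omega

end QueueMachine

namespace MultiHeadAutomaton

variable {k : ℕ}

/-- Assigns `x` to the first head and `y` to all other heads. -/
def headPair {β : Type*} (x y : β) : Fin k → β := fun i => if (i : ℕ) = 0 then x else y

theorem headPair_self {β : Type*} (x : β) : (headPair x x : Fin k → β) = fun _ => x := by
  funext i
  simp [headPair]

theorem map_headPair {β γ : Type*} (f : β → γ) (x y : β) :
    (fun i : Fin k => f (headPair x y i)) = headPair (f x) (f y) := by
  funext i
  simp only [headPair]
  split_ifs <;> rfl

theorem headPair_inj (hk : 2 ≤ k) {β : Type*} {x y x' y' : β} :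
    (headPair x y : Fin k → β) = headPair x' y' ↔ x = x' ∧ y = y' := by
  refine ⟨fun h => ⟨?_, ?_⟩, fun h => by rw [h.1, h.2]⟩
  · simpa [headPair] using congrFun h ⟨0, by omega⟩
  · simpa [headPair] using congrFun h ⟨1, by omega⟩

theorem headPair_mem {β : Type*} {p : β → Prop} {x y : β} (hx : p x) (hy : p y) (i : Fin k) :
    p (headPair x y i) := by
  simp only [headPair]
  split_ifs <;> assumption

/-- The transition from `s` to `s'` in which the first head scans `x` and moves by `d` while the
other heads scan `y` and move by `e`. -/
def pairEntry (k : ℕ) (s : ℕ) (x y : TapeSymbol) (s' : ℕ) (d e : HeadMove) :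
    (ℕ × (Fin k → TapeSymbol)) × (ℕ × (Fin k → HeadMove)) :=
  ((s, headPair x y), (s', headPair d e))

theorem Step.of_pairEntry_mem {M : MultiHeadAutomaton k} {w : List ℕ} {s s' : ℕ} {x y : TapeSymbol}
    {d e : HeadMove} (h : pairEntry k s x y s' d e ∈ M.trans) {i j i' j' : ℕ} (hx : scan w i = x)
    (hy : scan w j = y) (hi : (i' : ℤ) = i + d.toInt) (hj : (j' : ℤ) = j + e.toInt) :
    M.Step w (s, headPair i j) (s', headPair i' j') := by
  refine ⟨headPair d e, ?_, fun l => ?_⟩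
  · simpa only [map_headPair, hx, hy, pairEntry] using h
  · simp only [headPair]
    split_ifs <;> assumption

theorem Step.exists_mem {M : MultiHeadAutomaton k} {w : List ℕ} {s i j : ℕ} {c : Config k}
    (h : M.Step w (s, headPair i j) c) :
    ∃ t ∈ M.trans, t.1 = (s, headPair (scan w i) (scan w j)) ∧ c.1 = t.2.1 ∧
      ∀ l, (c.2 l : ℤ) = (headPair i j l : ℕ) + (t.2.2 l).toInt := by
  obtain ⟨d, hd, hm⟩ := h
  refine ⟨_, hd, ?_, rfl, hm⟩
  rw [map_headPair]

theorem Step.eq_of_moves {c : Config k} {s i j i' j' : ℕ} {d e : HeadMove} (hs : c.1 = s)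
    (hc : ∀ l, (c.2 l : ℤ) = (headPair i j l : ℕ) + ((headPair d e : Fin k → HeadMove) l).toInt)
    (hi : (i' : ℤ) = i + d.toInt) (hj : (j' : ℤ) = j + e.toInt) : c = (s, headPair i' j') := by
  refine Prod.ext hs (funext fun l => ?_)
  have := hc l
  simp only [headPair] at this ⊢
  split_ifs at this ⊢ <;> omega

theorem scan_succ_eq_letter {w : List ℕ} {p a : ℕ} :
    scan w (p + 1) = .letter a ↔ w[p]? = some a := by
  rcases h : w[p]? with _ | b <;> simp [scan, h]

theorem scan_succ_eq_rightEnd {w : List ℕ} {p : ℕ} :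
    scan w (p + 1) = .rightEnd ↔ w.length ≤ p := by
  rw [← List.getElem?_eq_none_iff]
  rcases h : w[p]? with _ | b <;> simp [scan, h]

end MultiHeadAutomaton

namespace QueueMachine

open StateTransition MultiHeadAutomaton Encodable

variable {Q Γ : Type*} [Primcodable Q] [Primcodable Γ]

/-- The tape symbol that stands for a queue symbol. -/
def tapeSymbol (a : Γ) : TapeSymbol := .letter (encode a)

theorem tapeSymbol_inj {a b : Γ} : tapeSymbol a = tapeSymbol b ↔ a = b := by
  simp [tapeSymbol]

/-- The state of the automaton that stands for a state of the queue machine. -/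
def runState (q : Q) : ℕ := 2 * encode q + 2

/-- The state of the automaton in which `n` symbols of the initial queue are still to be compared
with the input. -/
def loadState (q₀ : Q) : ℕ → ℕ
  | 0 => runState q₀
  | n + 1 => 2 * n + 1

/-- The transitions that compare the input with the initial queue. -/
def loadEntries (k : ℕ) (q₀ : Q) (x : Γ) :
    List Γ → List ((ℕ × (Fin k → TapeSymbol)) × (ℕ × (Fin k → HeadMove)))
  | [] => []
  | b :: l => pairEntry k (loadState q₀ (l.length + 1)) (tapeSymbol x) (tapeSymbol b)
      (loadState q₀ l.length) .stay .right :: loadEntries k q₀ x l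

theorem mem_loadEntries {k : ℕ} {q₀ : Q} {x : Γ} {l : List Γ}
    {t : (ℕ × (Fin k → TapeSymbol)) × (ℕ × (Fin k → HeadMove))} :
    t ∈ loadEntries k q₀ x l ↔ ∃ b l', b :: l' <:+ l ∧
      t = pairEntry k (loadState q₀ (l'.length + 1)) (tapeSymbol x) (tapeSymbol b)
        (loadState q₀ l'.length) .stay .right := by
  induction l with
  | nil => simp [loadEntries]
  | cons a l ih =>
    rw [loadEntries, List.mem_cons, ih]
    constructor
    · rintro (rfl | ⟨b, l', h, rfl⟩)
      · exact ⟨a, l, List.suffix_rfl, rfl⟩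
      · exact ⟨b, l', h.trans (List.suffix_cons _ _), rfl⟩
    · rintro ⟨b, l', h, rfl⟩
      rcases List.suffix_cons_iff.1 h with h | h
      · cases h
        exact .inl rfl
      · exact .inr ⟨b, l', h, rfl⟩

theorem runState_inj {q q' : Q} : runState q = runState q' ↔ q = q' := by
  simp [runState]

theorem runState_ne_loadState_succ {q q₀ : Q} {n : ℕ} : runState q ≠ loadState q₀ (n + 1) := by
  simp only [runState, loadState]
  omega

theorem eq_of_suffix_of_loadState_eq {β : Type*} {q₀ : Q} {a b : β} {l l' u : List β}
    (h : a :: l <:+ u) (h' : b :: l' <:+ u) (hs : loadState q₀ (l.length + 1) = loadState q₀ (l'.length + 1)) :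
    a = b ∧ l = l' := by
  have : l.length = l'.length := by
    simp only [loadState] at hs
    omega
  simpa using (List.suffix_of_suffix_length_le h h' (by simp [this])).eq_of_length (by simp [this])

theorem primrec_loadState (q₀ : Q) : Primrec (loadState q₀) := by
  have h : Primrec fun n : ℕ => 2 * n + 1 :=
    Primrec.nat_add.comp (Primrec.nat_mul.comp (.const 2) .id) (.const 1)
  exact (Primrec.nat_casesOn .id (.const (runState q₀)) (h.comp .snd).to₂).of_eq
    fun n => by cases n <;> rfl

variable [Fintype Q] [Fintype Γ]

/-- The transitions that simulate the queue machine: the first head reads the symbols at the front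
of the queue and the other heads compare the appended symbols with the input. -/
noncomputable def runEntries (k : ℕ) (δ : QueueMachine Q Γ) :
    List ((ℕ × (Fin k → TapeSymbol)) × (ℕ × (Fin k → HeadMove))) :=
  (Finset.univ : Finset (Q × Γ)).toList.flatMap fun p =>
    (δ p.1 p.2).toList.map fun r => pairEntry k (runState p.1) (tapeSymbol p.2) (tapeSymbol r.2.1)
      (runState r.1) (if r.2.2 then .right else .stay) .right

/-- The transitions to the accepting state at the end of the input. -/
noncomputable def acceptEntries (k : ℕ) (Q Γ : Type*) [Primcodable Q] [Primcodable Γ]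
    [Fintype Q] [Fintype Γ] : List ((ℕ × (Fin k → TapeSymbol)) × (ℕ × (Fin k → HeadMove))) :=
  (Finset.univ : Finset (Q × Γ)).toList.map fun p =>
    pairEntry k (runState p.1) (tapeSymbol p.2) .rightEnd 0 .stay .stay

/-- The one-way automaton that accepts the histories of the queue machine started in state `q₀` with
initial queue `x :: l`. -/
noncomputable def historyAutomaton (k : ℕ) (δ : QueueMachine Q Γ) (q₀ : Q) (p : Γ × List Γ) :
    MultiHeadAutomaton k where
  states := 0 :: ((Finset.univ : Finset Q).toList.map runState ++
    (List.range (p.2.length + 1)).map fun n => loadState q₀ (n + 1))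
  alphabet := (Finset.univ : Finset Γ).toList.map encode
  trans := loadEntries k q₀ p.1 (p.1 :: p.2) ++ (runEntries k δ ++ acceptEntries k Q Γ)
  start := loadState q₀ (p.2.length + 1)
  accepting := [0]

theorem mem_trans {k : ℕ} {δ : QueueMachine Q Γ} {q₀ : Q} {p : Γ × List Γ}
    {t : (ℕ × (Fin k → TapeSymbol)) × (ℕ × (Fin k → HeadMove))} :
    t ∈ (historyAutomaton k δ q₀ p).trans ↔
      (∃ b l, b :: l <:+ p.1 :: p.2 ∧
        t = pairEntry k (loadState q₀ (l.length + 1)) (tapeSymbol p.1) (tapeSymbol b)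
          (loadState q₀ l.length) .stay .right) ∨
      (∃ q a r, δ q a = some r ∧
        t = pairEntry k (runState q) (tapeSymbol a) (tapeSymbol r.2.1) (runState r.1)
          (if r.2.2 then .right else .stay) .right) ∨
      ∃ (q : Q) (a : Γ), t = pairEntry k (runState q) (tapeSymbol a) .rightEnd 0 .stay .stay := by
  simp only [historyAutomaton, List.mem_append, mem_loadEntries]
  refine or_congr_right (or_congr ?_ ?_)
  · simp only [runEntries, List.mem_flatMap, Finset.mem_toList, Finset.mem_univ, true_and,
      List.mem_map, Option.mem_toList, Prod.exists]
    constructor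
    · rintro ⟨q, a, q', c, b, h, rfl⟩
      exact ⟨q, a, q', c, b, h, rfl⟩
    · rintro ⟨q, a, q', c, b, h, rfl⟩
      exact ⟨q, a, q', c, b, h, rfl⟩
  · simp only [acceptEntries, List.mem_map, Finset.mem_toList, Finset.mem_univ, true_and,
      Prod.exists]
    exact exists₂_congr fun _ _ => eq_comm

theorem runState_mem_states {k : ℕ} {δ : QueueMachine Q Γ} {q₀ : Q} {p : Γ × List Γ} (q : Q) :
    runState q ∈ (historyAutomaton k δ q₀ p).states := by
  simp [historyAutomaton]

theorem loadState_mem_states {k : ℕ} {δ : QueueMachine Q Γ} {q₀ : Q} {p : Γ × List Γ} {n : ℕ}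
    (hn : n ≤ p.2.length + 1) : loadState q₀ n ∈ (historyAutomaton k δ q₀ p).states := by
  rcases n with _ | n
  · exact runState_mem_states q₀
  · simp only [historyAutomaton, List.mem_cons, List.mem_append, List.mem_map, List.mem_range]
    exact .inr (.inr ⟨n, by omega, rfl⟩)

theorem isTapeSymbol_tapeSymbol {k : ℕ} {δ : QueueMachine Q Γ} {q₀ : Q} {p : Γ × List Γ} (a : Γ) :
    (historyAutomaton k δ q₀ p).IsTapeSymbol (tapeSymbol a) := by
  simp [IsTapeSymbol, historyAutomaton, tapeSymbol]

theorem isAutomaton_historyAutomaton (k : ℕ) (δ : QueueMachine Q Γ) (q₀ : Q) (p : Γ × List Γ) :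
    (historyAutomaton k δ q₀ p).IsAutomaton := by
  have key : ∀ (s s' : ℕ) (x y : TapeSymbol) (d e : HeadMove),
      s ∈ (historyAutomaton k δ q₀ p).states → s' ∈ (historyAutomaton k δ q₀ p).states →
      (historyAutomaton k δ q₀ p).IsTapeSymbol x → (historyAutomaton k δ q₀ p).IsTapeSymbol y →
      d ≠ .left → e ≠ .left → x ≠ .rightEnd → (y = .rightEnd → e ≠ .right) →
      ∀ t, t = pairEntry k s x y s' d e →
      (t.1.1 ∈ (historyAutomaton k δ q₀ p).states ∧ t.2.1 ∈ (historyAutomaton k δ q₀ p).states) ∧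
        ∀ i : Fin k, (historyAutomaton k δ q₀ p).IsTapeSymbol (t.1.2 i) ∧
        (t.1.2 i = .leftEnd → t.2.2 i ≠ .left) ∧ (t.1.2 i = .rightEnd → t.2.2 i ≠ .right) := by
    rintro s s' x y d e hs hs' hx hy hd he hxr hyr t rfl
    refine ⟨⟨hs, hs'⟩, fun i => ⟨headPair_mem hx hy i,
      fun _ => headPair_mem (p := fun d => d ≠ HeadMove.left) hd he i, fun h => ?_⟩⟩
    simp only [pairEntry, headPair] at h ⊢
    split_ifs at h ⊢
    · exact absurd h hxr
    · exact hyr h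
  have hne : ∀ a : Γ, tapeSymbol a ≠ .rightEnd := fun a => by simp [tapeSymbol]
  refine ⟨loadState_mem_states le_rfl, by simp [historyAutomaton], fun t ht => ?_⟩
  rcases mem_trans.1 ht with ⟨b, l, hl, ht⟩ | ⟨q, a, r, -, ht⟩ | ⟨q, a, ht⟩
  · have := hl.length_le
    simp only [List.length_cons] at this
    exact key _ _ _ _ _ _ (loadState_mem_states (by omega)) (loadState_mem_states (by omega))
      (isTapeSymbol_tapeSymbol _) (isTapeSymbol_tapeSymbol _) (by simp) (by simp) (hne _)
      (fun h => absurd h (hne _)) t ht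
  · exact key _ _ _ _ _ _ (runState_mem_states _) (runState_mem_states _)
      (isTapeSymbol_tapeSymbol _) (isTapeSymbol_tapeSymbol _) (by split_ifs <;> simp) (by simp)
      (hne _) (fun h => absurd h (hne _)) t ht
  · exact key _ _ _ _ _ _ (runState_mem_states _) (by simp [historyAutomaton])
      (isTapeSymbol_tapeSymbol _) (.inr (.inl rfl)) (by simp) (by simp) (hne _) (by simp) t ht

theorem isOneWay_historyAutomaton (k : ℕ) (δ : QueueMachine Q Γ) (q₀ : Q) (p : Γ × List Γ) :
    (historyAutomaton k δ q₀ p).IsOneWay := by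
  intro t ht i
  rcases mem_trans.1 ht with ⟨b, l, hl, rfl⟩ | ⟨q, a, r, -, rfl⟩ | ⟨q, a, rfl⟩
  · exact headPair_mem (p := fun d => d ≠ HeadMove.left) (by simp) (by simp) i
  · exact headPair_mem (p := fun d => d ≠ HeadMove.left) (by split_ifs <;> simp) (by simp) i
  · exact headPair_mem (p := fun d => d ≠ HeadMove.left) (by simp) (by simp) i

theorem isDeterministic_historyAutomaton {k : ℕ} (hk : 2 ≤ k) (δ : QueueMachine Q Γ) (q₀ : Q)
    (p : Γ × List Γ) : (historyAutomaton k δ q₀ p).IsDeterministic := by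
  intro t ht t' ht' h
  rcases mem_trans.1 ht with ⟨b, l, hl, rfl⟩ | ⟨q, a, r, hr, rfl⟩ | ⟨q, a, rfl⟩ <;>
  rcases mem_trans.1 ht' with ⟨b', l', hl', rfl⟩ | ⟨q', a', r', hr', rfl⟩ | ⟨q', a', rfl⟩ <;>
  simp only [pairEntry, Prod.mk.injEq, headPair_inj hk, tapeSymbol_inj, runState_inj] at h
  · obtain ⟨rfl, rfl⟩ := eq_of_suffix_of_loadState_eq hl hl' h.1
    rfl
  · exact absurd h.1.symm runState_ne_loadState_succ
  · exact absurd h.1.symm runState_ne_loadState_succ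
  · exact absurd h.1 runState_ne_loadState_succ
  · obtain ⟨rfl, rfl, -⟩ := h
    cases hr.symm.trans hr'
    rfl
  · simp [tapeSymbol] at h
  · exact absurd h.1 runState_ne_loadState_succ
  · simp [tapeSymbol] at h
  · rfl

end QueueMachine

namespace QueueMachine

open StateTransition MultiHeadAutomaton Encodable

variable {Q Γ : Type*} [Primcodable Q] [Primcodable Γ]

theorem scan_eq_tapeSymbol {w : List ℕ} {i : ℕ} {a : Γ} :
    scan w (i + 1) = tapeSymbol a ↔ w[i]? = some (encode a) := scan_succ_eq_letter

theorem getElem?_of_append_singleton_prefix {s : List Γ} {a : Γ} {w : List ℕ}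
    (h : (s ++ [a]).map encode <+: w) : w[s.length]? = some (encode a) := by
  obtain ⟨t, rfl⟩ := h
  simp

theorem append_singleton_prefix {s : List Γ} {a : Γ} {w : List ℕ} (h : s.map encode <+: w)
    (ha : w[s.length]? = some (encode a)) : (s ++ [a]).map encode <+: w := by
  obtain ⟨t, rfl⟩ := h
  rcases t with _ | ⟨b, t⟩
  · simp at ha
  · simp only [List.getElem?_append_right, List.length_map, le_refl, Nat.sub_self,
      List.getElem?_cons_zero, Option.some.injEq] at ha
    subst ha
    exact ⟨t, by simp⟩

theorem getElem?_of_prefix {s : List Γ} {w : List ℕ} (h : s.map encode <+: w) {i : ℕ}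
    (hi : i < s.length) : w[i]? = s[i]?.map encode := by
  obtain ⟨t, rfl⟩ := h
  rw [List.getElem?_append_left (by simpa using hi), List.getElem?_map]

/-- The configuration of the automaton that stands for a configuration of the queue machine. -/
def runConfig (k : ℕ) (c : Q × ℕ × List Γ) : Config k :=
  (runState c.1, headPair (c.2.1 + 1) (c.2.2.length + 1))

theorem primrec_loadEntries [Finite Γ] (k : ℕ) (q₀ : Q) :
    Primrec₂ (loadEntries k q₀ : Γ → List Γ → _) := by
  have hx : Primrec fun t : (Γ × List Γ) × (Γ × List Γ ×
      List ((ℕ × (Fin k → TapeSymbol)) × (ℕ × (Fin k → HeadMove)))) => (t.1.1, t.2.1) :=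
    (Primrec.fst.comp .fst).pair (Primrec.fst.comp .snd)
  have hp : Primrec fun u : Γ × Γ => (headPair (tapeSymbol u.1) (tapeSymbol u.2) :
      Fin k → TapeSymbol) := Primrec.dom_finite _
  have hl : Primrec fun t : (Γ × List Γ) × (Γ × List Γ ×
      List ((ℕ × (Fin k → TapeSymbol)) × (ℕ × (Fin k → HeadMove)))) => t.2.2.1.length :=
    Primrec.list_length.comp (Primrec.fst.comp (Primrec.snd.comp .snd))
  have hrec := Primrec.list_rec (f := fun p : Γ × List Γ => p.2)
    (g := fun _ => ([] : List ((ℕ × (Fin k → TapeSymbol)) × (ℕ × (Fin k → HeadMove)))))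
    (h := fun p t => pairEntry k (loadState q₀ (t.2.1.length + 1)) (tapeSymbol p.1)
      (tapeSymbol t.1) (loadState q₀ t.2.1.length) .stay .right :: t.2.2) .snd (.const [])
    (Primrec.list_cons.comp
      ((((primrec_loadState q₀).comp (Primrec.succ.comp hl)).pair (hp.comp hx)).pair
        (((primrec_loadState q₀).comp hl).pair (.const (headPair HeadMove.stay HeadMove.right : Fin k → HeadMove))))
      (Primrec.snd.comp (Primrec.snd.comp .snd))).to₂
  refine hrec.of_eq fun p => ?_
  obtain ⟨x, l⟩ := p
  dsimp only
  induction l with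
  | nil => rfl
  | cons b l ih => rw [loadEntries, ← ih]

variable [Fintype Q] [Fintype Γ]

section Acceptance

variable {k : ℕ} {δ : QueueMachine Q Γ} {q₀ : Q} {p : Γ × List Γ} {w : List ℕ}

theorem reaches_load (hw : (p.1 :: p.2).map encode <+: w) {s l : List Γ}
    (hsl : s ++ l = p.1 :: p.2) :
    Relation.ReflTransGen ((historyAutomaton k δ q₀ p).Step w)
      ((historyAutomaton k δ q₀ p).start, fun _ => 1)
      (loadState q₀ l.length, headPair 1 (s.length + 1)) := by
  induction s using List.reverseRecOn generalizing l with
  | nil =>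
    obtain rfl : l = p.1 :: p.2 := by simpa using hsl
    rw [List.length_nil, headPair_self]
    exact .refl
  | append_singleton s a ih =>
    have hsl' : s ++ a :: l = p.1 :: p.2 := by simpa using hsl
    refine (ih hsl').tail (Step.of_pairEntry_mem
      (mem_trans.2 (.inl ⟨a, l, ⟨s, hsl'⟩, rfl⟩)) ?_ ?_ ?_ ?_)
    · refine scan_eq_tapeSymbol.2 ?_
      rw [getElem?_of_prefix hw (by simp)]
      rfl
    · refine scan_eq_tapeSymbol.2 (getElem?_of_append_singleton_prefix (.trans ?_ hw))
      rw [← hsl]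
      exact (List.prefix_append _ _).map _
    · simp [HeadMove.toInt]
    · simp [HeadMove.toInt]

theorem reaches_run {c : Q × ℕ × List Γ} (h : Reaches (historyStep δ) (q₀, 0, p.1 :: p.2) c)
    (hw : c.2.2.map encode <+: w) :
    Relation.ReflTransGen ((historyAutomaton k δ q₀ p).Step w)
      ((historyAutomaton k δ q₀ p).start, fun _ => 1) (runConfig k c) := by
  induction h with
  | refl => exact reaches_load hw (List.append_nil _)
  | @tail c c' hc hcc ih =>
    have hlt := removed_lt_length_of_reaches hc (by simp)
    obtain ⟨a, r, ha, hr, rfl⟩ := (historyStep_eq_some δ).1 hcc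
    have hw' : c.2.2.map encode <+: w := ((List.prefix_append _ _).map _).trans hw
    refine (ih hw').tail (Step.of_pairEntry_mem
      (mem_trans.2 (.inr (.inl ⟨c.1, a, r, hr, rfl⟩))) ?_ ?_ ?_ ?_)
    · rw [scan_eq_tapeSymbol, getElem?_of_prefix hw' hlt, ha]
      rfl
    · exact scan_eq_tapeSymbol.2 (getElem?_of_append_singleton_prefix hw)
    · dsimp only
      split_ifs <;> simp [HeadMove.toInt]
    · simp [HeadMove.toInt]

theorem invariant_of_reaches (hk : 2 ≤ k) {d : Config k}
    (h : Relation.ReflTransGen ((historyAutomaton k δ q₀ p).Step w)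
      ((historyAutomaton k δ q₀ p).start, fun _ => 1) d) :
    (∃ s b l, s ++ b :: l = p.1 :: p.2 ∧ s.map encode <+: w ∧
      d = (loadState q₀ (l.length + 1), headPair 1 (s.length + 1))) ∨
    (∃ c, Reaches (historyStep δ) (q₀, 0, p.1 :: p.2) c ∧ c.2.2.map encode <+: w ∧
      d = runConfig k c) ∨
    (d.1 = 0 ∧ ∃ c, Reaches (historyStep δ) (q₀, 0, p.1 :: p.2) c ∧ w = c.2.2.map encode) := by
  induction h with
  | refl =>
    refine .inl ⟨[], p.1, p.2, rfl, List.nil_prefix, ?_⟩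
    rw [List.length_nil, headPair_self]
    rfl
  | @tail d d' _ hd ih =>
    rcases ih with ⟨s, b, l, hs, hw, rfl⟩ | ⟨c, hc, hw, rfl⟩ | ⟨h0, -⟩
    · obtain ⟨t, ht, h1, h2, h3⟩ := hd.exists_mem
      rcases mem_trans.1 ht with ⟨b', l', hl, rfl⟩ | ⟨q, a, r, hr, rfl⟩ | ⟨q, a, rfl⟩
      · simp only [pairEntry, Prod.mk.injEq, headPair_inj hk] at h1 h2 h3
        obtain ⟨rfl, rfl⟩ := eq_of_suffix_of_loadState_eq hl ⟨s, hs⟩ h1.1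
        have hw' := append_singleton_prefix hw (scan_eq_tapeSymbol.1 h1.2.2.symm)
        obtain rfl := Step.eq_of_moves (i' := 1) (j' := s.length + 1 + 1) h2 h3
          (by simp [HeadMove.toInt]) (by simp [HeadMove.toInt])
        rcases l' with _ | ⟨a, l⟩
        · exact .inr (.inl ⟨_, .refl, by rwa [← hs], by rw [runConfig, ← hs]; simp [loadState]⟩)
        · exact .inl ⟨s ++ [b'], a, l, by simpa using hs, hw', by simp⟩
      · exact absurd (congrArg Prod.fst h1) (runState_ne_loadState_succ (q₀ := q₀))
      · exact absurd (congrArg Prod.fst h1) (runState_ne_loadState_succ (q₀ := q₀))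
    · have hlt := removed_lt_length_of_reaches hc (by simp)
      obtain ⟨t, ht, h1, h2, h3⟩ := hd.exists_mem
      rcases mem_trans.1 ht with ⟨b', l', hl, rfl⟩ | ⟨q, a, r, hr, rfl⟩ | ⟨q, a, rfl⟩
      · exact absurd (congrArg Prod.fst h1).symm (runState_ne_loadState_succ (q₀ := q₀))
      · simp only [pairEntry, Prod.mk.injEq, headPair_inj hk, runState_inj] at h1 h2 h3
        obtain ⟨rfl, h1, h4⟩ := h1
        have ha : c.2.2[c.2.1]? = some a := by
          have := scan_eq_tapeSymbol.1 h1.symm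
          rw [getElem?_of_prefix hw hlt, Option.map_eq_some_iff] at this
          obtain ⟨a', ha', h⟩ := this
          rwa [← encode_injective h]
        refine .inr (.inl ⟨_, hc.tail ((historyStep_eq_some δ).2 ⟨a, r, ha, hr, rfl⟩),
          append_singleton_prefix hw (scan_eq_tapeSymbol.1 h4.symm), ?_⟩)
        refine Step.eq_of_moves h2 h3 ?_ ?_
        · split_ifs <;> simp [HeadMove.toInt]
        · simp [HeadMove.toInt]
      · simp only [pairEntry, Prod.mk.injEq, headPair_inj hk] at h1 h2
        refine .inr (.inr ⟨h2, c, hc, (hw.eq_of_length_le ?_).symm⟩)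
        simpa using scan_succ_eq_rightEnd.1 h1.2.2.symm
    · obtain ⟨e, he, -⟩ := hd
      rcases mem_trans.1 he with ⟨b', l', hl, h⟩ | ⟨q, a, r, hr, h⟩ | ⟨q, a, h⟩ <;>
      · have := (congrArg (fun t => t.1.1) h).symm.trans h0
        simp [pairEntry, runState, loadState] at this

theorem mem_accepts_historyAutomaton (hk : 2 ≤ k) :
    w ∈ (historyAutomaton k δ q₀ p).accepts ↔
      ∃ c, Reaches (historyStep δ) (q₀, 0, p.1 :: p.2) c ∧ w = c.2.2.map encode := by
  constructor
  · rintro ⟨-, d, hd, h0, -⟩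
    have h0 : d.1 = 0 := by simpa [historyAutomaton] using h0
    rcases invariant_of_reaches hk hd with ⟨s, b, l, -, -, rfl⟩ | ⟨c, -, -, rfl⟩ | ⟨-, h⟩
    · simp [loadState] at h0
    · simp [runConfig, runState] at h0
    · exact h
  · rintro ⟨c, hc, rfl⟩
    have hlt := removed_lt_length_of_reaches hc (by simp)
    refine ⟨by simp [historyAutomaton], (0, headPair (c.2.1 + 1) (c.2.2.length + 1)),
      (reaches_run hc List.prefix_rfl).tail (Step.of_pairEntry_mem
        (mem_trans.2 (.inr (.inr ⟨c.1, c.2.2[c.2.1], rfl⟩))) ?_ ?_ ?_ ?_), ?_, ?_⟩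
    · rw [scan_eq_tapeSymbol]
      simp [hlt]
    · rw [scan_succ_eq_rightEnd]
      simp
    · simp [HeadMove.toInt]
    · simp [HeadMove.toInt]
    · simp [historyAutomaton]
    · intro y hy
      rcases mem_trans.1 hy with ⟨b', l', hl, h⟩ | ⟨q, a, r, hr, h⟩ | ⟨q, a, h⟩ <;>
      · have := congrArg (fun t => t.1.1) h
        simp [pairEntry, runState, loadState] at this

end Acceptance

theorem primrec_historyAutomaton (k : ℕ) (δ : QueueMachine Q Γ) (q₀ : Q) :
    Primrec (historyAutomaton k δ q₀) := by
  have hl : Primrec fun p : Γ × List Γ => p.2.length + 1 :=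
    Primrec.succ.comp (Primrec.list_length.comp .snd)
  have hstates : Primrec fun p : Γ × List Γ => (historyAutomaton k δ q₀ p).states :=
    Primrec.list_cons.comp (.const 0) (Primrec.list_append.comp (.const _)
      (Primrec.list_map (Primrec.list_range.comp hl)
        ((primrec_loadState q₀).comp (Primrec.succ.comp .snd)).to₂))
  have htrans : Primrec fun p : Γ × List Γ => (historyAutomaton k δ q₀ p).trans :=
    Primrec.list_append.comp ((primrec_loadEntries k q₀).comp .fst
      (Primrec.list_cons.comp .fst .snd)) (.const _)
  have hstart : Primrec fun p : Γ × List Γ => (historyAutomaton k δ q₀ p).start :=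
    (primrec_loadState q₀).comp hl
  exact (Primrec.of_equiv_symm (e := equivProd)).comp
    (hstates.pair ((Primrec.const _).pair (htrans.pair (hstart.pair (.const [0])))))

end QueueMachine

namespace QueueMachine

open StateTransition MultiHeadAutomaton Encodable

section Decidability

variable {Q Γ : Type*} [Primcodable Q] [Primcodable Γ] [Finite Q] [Finite Γ]

theorem primrec_historyStep (δ : QueueMachine Q Γ) : Primrec (historyStep δ) := by
  have hδ : Primrec fun u : Q × Γ => δ u.1 u.2 := Primrec.dom_finite _
  have hr : Primrec fun t : ((Q × ℕ × List Γ) × Γ) × (Q × Γ × Bool) =>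
      (t.2.1, (if t.2.2.2 then t.1.1.2.1 + 1 else t.1.1.2.1), t.1.1.2.2 ++ [t.2.2.1]) := by
    have hi : Primrec fun t : ((Q × ℕ × List Γ) × Γ) × (Q × Γ × Bool) => t.1.1.2.1 :=
      Primrec.fst.comp (Primrec.snd.comp (Primrec.fst.comp .fst))
    have hs : Primrec fun t : ((Q × ℕ × List Γ) × Γ) × (Q × Γ × Bool) => t.1.1.2.2 :=
      Primrec.snd.comp (Primrec.snd.comp (Primrec.fst.comp .fst))
    refine (Primrec.fst.comp .snd).pair (Primrec.pair (Primrec.ite ?_ (Primrec.succ.comp hi) hi)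
      (Primrec.list_concat.comp hs (Primrec.fst.comp (Primrec.snd.comp .snd))))
    exact Primrec.eq.comp (Primrec.snd.comp (Primrec.snd.comp .snd)) (.const true)
  exact Primrec.option_bind
    (Primrec.list_getElem?.comp (Primrec.snd.comp .snd) (Primrec.fst.comp .snd))
    (Primrec.option_map (hδ.comp ((Primrec.fst.comp .fst).pair .snd)) hr.to₂).to₂

/-- The configuration after `n` steps. -/
def run (δ : QueueMachine Q Γ) (n : ℕ) (c : Q × ℕ × List Γ) : Option (Q × ℕ × List Γ) :=
  (fun o => o.bind (historyStep δ))^[n] (some c)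

theorem primrec_run (δ : QueueMachine Q Γ) : Primrec₂ (run δ) :=
  Primrec.nat_iterate .fst (Primrec.option_some.comp .snd)
    (Primrec.option_bind .snd ((primrec_historyStep δ).comp .snd).to₂).to₂

omit [Primcodable Q] [Primcodable Γ] [Finite Q] [Finite Γ] in
theorem run_succ (δ : QueueMachine Q Γ) (n : ℕ) (c : Q × ℕ × List Γ) :
    run δ (n + 1) c = (run δ n c).bind (historyStep δ) :=
  Function.iterate_succ_apply' _ _ _

omit [Primcodable Q] [Primcodable Γ] [Finite Q] [Finite Γ] in
theorem reaches_of_run_eq_some {δ : QueueMachine Q Γ} {n : ℕ} {c c' : Q × ℕ × List Γ}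
    (h : run δ n c = some c') :
    Reaches (historyStep δ) c c' ∧ c'.2.2.length = c.2.2.length + n := by
  induction n generalizing c' with
  | zero =>
    obtain rfl : c = c' := by simpa [run] using h
    exact ⟨.refl, rfl⟩
  | succ n ih =>
    rw [run_succ, Option.bind_eq_some_iff] at h
    obtain ⟨d, hd, h⟩ := h
    obtain ⟨hr, hl⟩ := ih hd
    refine ⟨hr.tail h, ?_⟩
    obtain ⟨a, r, -, -, rfl⟩ := (historyStep_eq_some δ).1 h
    simp only [List.length_append, List.length_singleton, hl]
    omega

omit [Primcodable Q] [Primcodable Γ] [Finite Q] [Finite Γ] in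
theorem dom_of_run_eq_none {δ : QueueMachine Q Γ} {n : ℕ} {c : Q × ℕ × List Γ}
    (h : run δ n c = none) : (eval (historyStep δ) c).Dom := by
  induction n with
  | zero => simp [run] at h
  | succ n ih =>
    rw [run_succ] at h
    rcases hd : run δ n c with _ | d
    · exact ih hd
    · rw [hd, Option.bind_some] at h
      exact Part.dom_iff_mem.2 ⟨d, mem_eval.2 ⟨(reaches_of_run_eq_some hd).1, h⟩⟩

omit [Primcodable Q] [Primcodable Γ] [Finite Q] [Finite Γ] in
theorem exists_length_le_of_dom {δ : QueueMachine Q Γ} {c : Q × ℕ × List Γ}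
    (h : (eval (historyStep δ) c).Dom) :
    ∃ n, ∀ d, Reaches (historyStep δ) c d → d.2.2.length ≤ n := by
  obtain ⟨b, hb⟩ := Part.dom_iff_mem.1 h
  refine ⟨b.2.2.length, fun d hd => ?_⟩
  have := hb
  rw [reaches_eval hd] at this
  exact (prefix_of_reaches (mem_eval.1 this).1).length_le

end Decidability

theorem _root_.LanguageFamily.IsPumpable.exists_length_lt {L : Language ℕ} {z : List ℕ}
    (h : LanguageFamily.IsPumpable L z) (n : ℕ) : ∃ w ∈ L, n < w.length := by
  obtain ⟨u, v, x, -, hv, hinf⟩ := h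
  obtain ⟨i, ⟨u', x', hi⟩, hn⟩ := hinf.exists_gt n
  refine ⟨_, hi, ?_⟩
  have : i ≤ i * v.length := Nat.le_mul_of_pos_right _ hv
  simp only [List.length_append, List.length_flatten, List.map_replicate, List.sum_replicate,
    smul_eq_mul]
  omega

/-- If a family with a pumping lemma effectively contains the languages of one-way deterministic
`k`-head automata, then the halting problem of every queue machine is decidable. -/
theorem computablePred_dom_of_possessesPumpingLemma {α : Type*} [Primcodable α]
    {E : LanguageFamily α} {k : ℕ} (hk : 2 ≤ k) (hE : E.EffectivelyContains (oneWayDFA k))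
    (hpump : E.PossessesPumpingLemma) {Q Γ : Type*} [Primcodable Q] [Primcodable Γ] [Fintype Q]
    [Fintype Γ] (δ : QueueMachine Q Γ) (q₀ : Q) :
    ComputablePred fun p : Γ × List Γ => (eval (historyStep δ) (q₀, 0, p.1 :: p.2)).Dom := by
  obtain ⟨g, hg, hgE⟩ := hE
  obtain ⟨n, hn, hnE⟩ := hpump
  have hA := (primrec_historyAutomaton k δ q₀).to_comp
  have hrun : Computable fun p : Γ × List Γ =>
      run δ (n (g (historyAutomaton k δ q₀ p))) (q₀, 0, p.1 :: p.2) :=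
    (primrec_run δ).to_comp.comp (hn.comp (hg.comp hA))
      ((Computable.const q₀).pair ((Computable.const 0).pair Primrec.list_cons.to_comp))
  refine ComputablePred.computable_iff.2
    ⟨_, Primrec.not.to_comp.comp (Primrec.option_isSome.to_comp.comp hrun), funext fun p => ?_⟩
  simp only [Bool.not_eq_true', Option.isSome_eq_false_iff, Option.isNone_iff_eq_none, eq_iff_iff]
  refine ⟨fun hdom => ?_, dom_of_run_eq_none⟩
  by_contra hne
  obtain ⟨c, hc⟩ := Option.ne_none_iff_exists'.1 hne
  obtain ⟨hreach, hlen⟩ := reaches_of_run_eq_some hc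
  obtain ⟨hD, hL⟩ := hgE (historyAutomaton k δ q₀ p)
    ⟨isAutomaton_historyAutomaton k δ q₀ p, isOneWay_historyAutomaton k δ q₀ p,
      isDeterministic_historyAutomaton hk δ q₀ p⟩
  have hmem : ∀ w, w ∈ E.lang (g (historyAutomaton k δ q₀ p)) ↔
      ∃ c, Reaches (historyStep δ) (q₀, 0, p.1 :: p.2) c ∧ w = c.2.2.map encode := by
    intro w
    rw [hL]
    exact mem_accepts_historyAutomaton hk
  obtain ⟨b, hb⟩ := exists_length_le_of_dom hdom
  obtain ⟨w, hw, hbw⟩ := (hnE _ hD _ ((hmem _).2 ⟨c, hreach, rfl⟩) (by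
    simp only [List.length_map, hlen, List.length_cons]
    omega)).exists_length_lt b
  obtain ⟨d, hd, rfl⟩ := (hmem w).1 hw
  have := hb d hd
  simp only [List.length_map] at hbw
  omega

end QueueMachine

open Turing StateTransition

/-- The modes of a queue machine that simulates a Turing machine by sweeping over its tape: it looks
for the scanned cell, or marks the next cell as the scanned one, or passes to the end. -/
inductive SweepMode (Λ : Type*) where
  | seek : Λ → SweepMode Λ
  | mark : Λ → SweepMode Λ
  | pass : Λ → SweepMode Λ
  deriving Fintype

namespace SweepMode

variable {Γ Λ : Type*} [Inhabited Γ]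

/-- The queue contains a cyclic copy of the tape; `none` separates the ends of the tape, and the
scanned cell is the marked one. The most recently read symbol is kept in the state until the next
step, which may still change it. -/
def machine (M : Λ → Γ → Option (Λ × TM0.Stmt Γ)) :
    QueueMachine (SweepMode Λ × Option (Γ × Bool)) (Option (Γ × Bool))
  | (seek q, p), some (h, true) =>
    match M q h with
    | none => none
    | some (q', .write a) => some ((pass q', some (a, true)), p, true)
    | some (q', .move .right) => some ((mark q', some (h, false)), p, true)
    | some (q', .move .left) =>
      match p with
      | some (g, _) => some ((pass q', some (h, false)), some (g, true), true)
      | none => some ((pass q', some (default, true)), none, false)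
  | (seek q, p), some (g, false) => some ((seek q, some (g, false)), p, true)
  | (seek q, p), none => some ((seek q, none), p, true)
  | (mark q, p), some (g, _) => some ((pass q, some (g, true)), p, true)
  | (mark q, p), none => some ((pass q, some (default, true)), p, false)
  | (pass q, p), some (g, _) => some ((pass q, some (g, false)), p, true)
  | (pass q, p), none => some ((seek q, none), p, true)

/-- The queue symbol for a cell that is not scanned. -/
def plain (g : Γ) : Option (Γ × Bool) := some (g, false)

variable {M : Λ → Γ → Option (Λ × TM0.Stmt Γ)}

theorem reaches_seek {q : Λ} {l : List Γ} {p p' : Option (Γ × Bool)}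
    {o t : List (Option (Γ × Bool))} (h : o ++ [p'] = p :: l.map plain) :
    Reaches ((machine M).step) ((seek q, p), l.map plain ++ t) ((seek q, p'), t ++ o) := by
  induction l generalizing p o t with
  | nil =>
    obtain ⟨rfl, rfl⟩ : o = [] ∧ p' = p := by simpa [List.append_eq_singleton_iff] using h
    rw [List.append_nil, List.map_nil, List.nil_append]
    exact .refl
  | cons g l ih =>
    rcases o with _ | ⟨x, o⟩
    · simp at h
    obtain ⟨rfl, h'⟩ : x = p ∧ o ++ [p'] = plain g :: l.map plain := by simpa using h
    refine .head (b := ((seek q, plain g), l.map plain ++ (t ++ [x]))) ?_ ?_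
    · simp [QueueMachine.step, machine, plain]
    · change Reaches (machine M).step _ _
      simpa only [List.append_assoc, List.singleton_append] using ih (t := t ++ [x]) h'

theorem reaches_pass {q : Λ} {s : List (Γ × Bool)} {p : Option (Γ × Bool)}
    {t : List (Option (Γ × Bool))} :
    Reaches ((machine M).step) ((pass q, p), s.map some ++ none :: t)
      ((seek q, none), t ++ p :: s.map fun g => plain g.1) := by
  induction s generalizing p t with
  | nil => exact .single (by simp [QueueMachine.step, machine])
  | cons g s ih =>
    refine .head (b := ((pass q, plain g.1), s.map some ++ none :: (t ++ [p]))) ?_ ?_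
    · simp [QueueMachine.step, machine, plain]
    · change Reaches (machine M).step _ _
      simpa only [List.append_assoc, List.cons_append, List.nil_append, List.map_cons]
        using ih (t := t ++ [p])

variable {Λ' : Type*} [Inhabited Λ']

/-- The configurations of the queue machine that stand for a configuration of the Turing machine. -/
def Represents (f : Λ → Λ') (c : TM0.Cfg Γ Λ')
    (d : (SweepMode Λ × Option (Γ × Bool)) × List (Option (Γ × Bool))) : Prop :=
  ∃ q l h r o p, c = ⟨f q, Tape.mk' (ListBlank.mk l) (ListBlank.mk (h :: r))⟩ ∧
    o ++ [p] = none :: l.reverse.map plain ∧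
    d = ((seek q, p), some (h, true) :: (r.map plain ++ o))

omit [Inhabited Λ'] in
theorem exists_represents_of_pass (f : Λ → Λ') (q : Λ) (l : List Γ) (h : Γ) (r : List Γ)
    (s : List (Γ × Bool)) (t : List (Option (Γ × Bool))) {x : Option (Γ × Bool)}
    (ht : (t ++ x :: s.map fun g => plain g.1) =
      l.reverse.map plain ++ some (h, true) :: r.map plain) :
    ∃ d, Represents f ⟨f q, Tape.mk' (ListBlank.mk l) (ListBlank.mk (h :: r))⟩ d ∧
      Reaches ((machine M).step) ((pass q, x), s.map some ++ none :: t) d := by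
  obtain ⟨o, p, hop⟩ : ∃ o p, o ++ [p] = none :: l.reverse.map plain :=
    ⟨_, _, List.dropLast_append_getLast (List.cons_ne_nil _ _)⟩
  refine ⟨_, ⟨q, l, h, r, o, p, rfl, hop, rfl⟩, reaches_pass.trans ?_⟩
  rw [ht]
  exact reaches_seek hop

theorem machine_respects {M' : TM0.Machine Γ Λ'} {f : Λ → Λ'}
    (hM : ∀ q h, (M q h).map (Prod.map f id) = M' (f q) h) :
    Respects (TM0.step M') ((machine M).step) (Represents f) := by
  rintro _ _ ⟨q, l, h, r, o, p, rfl, hop, rfl⟩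
  simp only [TM0.step, Tape.mk'_head, ListBlank.head_mk, List.headI_cons, ← hM]
  have hmap : ∀ r : List Γ, (r.map fun g => (g, false)).map some = r.map plain := by
    simp [plain]
  rcases hq : M q h with _ | ⟨q', (d | a)⟩
  · simp [QueueMachine.step, machine, hq]
  · rcases d
    · rcases l with _ | ⟨g, l⟩
      · obtain ⟨rfl, rfl⟩ : o = [] ∧ p = none := by
          simpa [List.append_eq_singleton_iff] using hop
        obtain ⟨d, hd, hr⟩ := exists_represents_of_pass (M := M) f q' [] default (h :: r)
          ((h, true) :: r.map fun g => (g, false)) [] (x := some (default, true)) (by simp)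
        refine ⟨d, hd, .head' ?_ hr⟩
        simp [QueueMachine.step, machine, hq, plain]
      · obtain ⟨rfl, rfl⟩ : o = none :: l.reverse.map plain ∧ p = plain g := by
          refine List.append_singleton_inj.1 (hop.trans ?_)
          simp
        obtain ⟨d, hd, hr⟩ := exists_represents_of_pass (M := M) f q' l g (h :: r)
          (r.map fun g => (g, false)) (l.reverse.map plain ++ [some (g, true)]) (x := plain h)
          (by simp)
        refine ⟨d, hd, .head' ?_ hr⟩
        simp [QueueMachine.step, machine, hq, plain]
    · rcases r with _ | ⟨g, r⟩
      · obtain ⟨d, hd, hr⟩ := exists_represents_of_pass (M := M) f q' (h :: l) default []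
          [] (l.reverse.map plain ++ [plain h]) (x := some (default, true)) (by simp)
        have htape : (Tape.mk' (ListBlank.mk l) (ListBlank.mk [h])).move Dir.right =
            Tape.mk' (ListBlank.mk (h :: l)) (ListBlank.mk [default]) := by
          rw [Tape.move_right_mk']
          congr 1
          exact (ListBlank.cons_head_tail (ListBlank.mk [])).symm
        simp only [Option.map_some, Prod.map, id, htape]
        refine ⟨d, hd, .head' (b := ((mark q', plain h), none :: (l.reverse.map plain))) ?_
          (.head ?_ hr)⟩
        · simp [QueueMachine.step, machine, hq, plain, hop]
        · simp [QueueMachine.step, machine]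
      · obtain ⟨d, hd, hr⟩ := exists_represents_of_pass (M := M) f q' (h :: l) g r
          (r.map fun g => (g, false)) (l.reverse.map plain ++ [plain h]) (x := some (g, true))
          (by simp)
        refine ⟨d, hd, .head' (b := ((mark q', plain h),
          plain g :: (r.map plain ++ none :: l.reverse.map plain))) ?_ (.head ?_ hr)⟩
        · simp [QueueMachine.step, machine, hq, plain, hop]
        · simp [QueueMachine.step, machine, plain]
  · obtain ⟨d, hd, hr⟩ := exists_represents_of_pass (M := M) f q' l a r
      (r.map fun g => (g, false)) (l.reverse.map plain) (x := some (a, true)) (by simp)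
    refine ⟨d, by simpa using hd, .head' ?_ hr⟩
    simp [QueueMachine.step, machine, hq, hop, hmap]

/-- The halting problem of a Turing machine with finitely many states reduces to that of a queue
machine. -/
theorem _root_.QueueMachine.exists_dom_iff_of_supports {M : TM0.Machine Γ Λ'}
    {S : Finset Λ'} (hS : TM0.Supports M S) :
    ∃ (δ : QueueMachine (SweepMode S × Option (Γ × Bool)) (Option (Γ × Bool)))
      (q₀ : SweepMode S × Option (Γ × Bool)), ∀ h r,
      (eval δ.historyStep (q₀, 0, some (h, true) :: r.map plain)).Dom ↔
        (TM0.eval M (h :: r)).Dom := by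
  have hex : ∀ (q : S) (h : Γ), ∃ o : Option (S × TM0.Stmt Γ),
      o.map (Prod.map Subtype.val id) = M q h := by
    intro q h
    rcases hq : M q h with _ | ⟨q', s⟩
    · exact ⟨none, rfl⟩
    · exact ⟨some (⟨q', hS.2 hq q.2⟩, s), rfl⟩
  choose N hN using hex
  refine ⟨machine N, (seek ⟨default, hS.1⟩, none), fun h r => ?_⟩
  rw [QueueMachine.eval_historyStep_dom, ← List.append_nil (r.map plain)]
  exact tr_eval_dom (machine_respects hN) (a₂ := (_, _ :: (r.map plain ++ [])))
    ⟨⟨default, hS.1⟩, [], h, r, [], none, rfl, rfl, rfl⟩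

end SweepMode


section Halting

open Turing PartrecToTM2

theorem Turing.PartrecToTM2.trNat_eq (n : ℕ) :
    trNat n = if n = 0 then [] else
      (if n % 2 = 1 then Γ'.bit1 else Γ'.bit0) :: trNat (n / 2) := by
  split_ifs with h h1
  · rw [h, trNat_zero]
  · obtain ⟨m, rfl⟩ : ∃ m, n = Nat.bit true m := ⟨n / 2, by rw [Nat.bit_val]; simp; omega⟩
    rw [Nat.bit_div_two, trNat, ← Num.ofNat'_eq, Num.ofNat'_bit, trNat, ← Num.ofNat'_eq]
    rcases Num.ofNat' m with _ | m <;> rfl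
  · obtain ⟨m, rfl⟩ : ∃ m, n = Nat.bit false m := ⟨n / 2, by rw [Nat.bit_val]; simp; omega⟩
    have hm : ((m : Num) : ℕ) ≠ 0 := by
      rw [Num.to_of_nat]
      rintro rfl
      exact h rfl
    rw [Nat.bit_div_two, trNat, ← Num.ofNat'_eq, Num.ofNat'_bit, trNat, Num.ofNat'_eq]
    generalize (m : Num) = a at hm ⊢
    rcases a with _ | a
    · exact (hm Num.cast_zero).elim
    · rfl

theorem Turing.PartrecToTM2.primrec_trNat [Primcodable Γ'] : Primrec trNat := by
  have hlen : Primrec fun l : List (List Γ') => l.length := Primrec.list_length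
  have hhalf : Primrec fun l : List (List Γ') => l.length / 2 :=
    Primrec.nat_div.comp hlen (.const 2)
  have hbit : Primrec fun l : List (List Γ') => if l.length % 2 = 1 then Γ'.bit1 else Γ'.bit0 :=
    Primrec.ite (Primrec.eq.comp (Primrec.nat_mod.comp hlen (.const 2)) (.const 1)) (.const _)
      (.const _)
  have hg : Primrec fun l : List (List Γ') => if l.length = 0 then some [] else
      l[l.length / 2]?.map fun t => (if l.length % 2 = 1 then Γ'.bit1 else Γ'.bit0) :: t :=
    Primrec.ite (Primrec.eq.comp hlen (.const 0)) (.const _)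
      (Primrec.option_map (Primrec.list_getElem?.comp .id hhalf)
        (Primrec.list_cons.comp (hbit.comp .fst) .snd).to₂)
  refine (Primrec.nat_strong_rec (fun (_ : Unit) n => trNat n) (hg.comp .snd).to₂
    fun _ n => ?_).comp (.const ()) .id
  conv_rhs => rw [trNat_eq]
  simp only [List.length_map, List.length_range]
  split_ifs with h h1
  · rfl
  all_goals rw [List.getElem?_map, List.getElem?_range (by omega)]; rfl

instance Turing.PartrecToTM2.instFintypeK' : Fintype K' :=
  ⟨{.main, .rev, .aux, .stack}, fun k => by cases k <;> simp⟩

/-- The halting problem for codes of partial recursive functions reduces to the halting problem of a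
single queue machine. -/
theorem QueueMachine.exists_dom_iff_code_dom :
    ∃ (Q Γ : Type) (_ : Fintype Q) (_ : Fintype Γ) (_ : Primcodable Q) (_ : Primcodable Γ)
      (δ : QueueMachine Q Γ) (q₀ : Q) (u : Nat.Partrec.Code → Γ × List Γ), Computable u ∧
      ∀ e, (StateTransition.eval δ.historyStep (q₀, 0, (u e).1 :: (u e).2)).Dom ↔
        (e.eval 0).Dom := by
  have hf : Partrec fun n : ℕ => (Denumerable.ofNat Nat.Partrec.Code n).eval 0 :=
    Nat.Partrec.Code.eval_part.comp (Computable.ofNat _) (Computable.const 0)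
  obtain ⟨c, hc⟩ := ToPartrec.Code.exists_code (Nat.Partrec'.part_iff₁.2 hf)
  let : Inhabited Λ' := ⟨trNormal c Cont'.halt⟩
  obtain ⟨δ, q₀, hδ⟩ := QueueMachine.exists_dom_iff_of_supports
    (TM1to0.tr_supports _ (TM2to1.tr_supports _ (PartrecToTM2.tr_supports c Cont'.halt)))
  let hΓ' : Primcodable Γ' := Primcodable.ofEquiv _ (Fintype.equivFin Γ')
  let hA : Primcodable (TM2to1.Γ' K' fun _ => Γ') := Primcodable.ofEquiv _ (Fintype.equivFin _)
  let cell : Γ' → TM2to1.Γ' K' fun _ => Γ' :=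
    fun a => (false, Function.update (fun _ => none) K'.main (some a))
  let bottom : (TM2to1.Γ' K' fun _ => Γ') → TM2to1.Γ' K' fun _ => Γ' := fun a => (true, a.2)
  let input : Nat.Partrec.Code → List (TM2to1.Γ' K' fun _ => Γ') :=
    fun e => (trList [Encodable.encode e]).reverse.map cell
  have hinput : Primrec input :=
    Primrec.list_map (Primrec.list_reverse.comp (Primrec.list_append.comp
      (primrec_trNat.comp Primrec.encode) (.const [Γ'.cons])))
      ((Primrec.dom_finite cell).comp .snd).to₂
  refine ⟨_, _, inferInstance, inferInstance, Primcodable.ofEquiv _ (Fintype.equivFin _),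
    inferInstance, δ, q₀,
    fun e => (some (bottom (input e).headI, true), (input e).tail.map SweepMode.plain), ?_,
    fun e => ?_⟩
  · refine Primrec.to_comp (.pair ?_ (Primrec.list_map (Primrec.list_tail.comp hinput)
      ((Primrec.dom_finite SweepMode.plain).comp .snd).to₂))
    exact (Primrec.dom_finite fun a => some (bottom a, true)).comp
      (Primrec.list_headI.comp hinput)
  · refine (hδ _ _).trans ?_
    rw [TM1to0.tr_eval]
    refine (TM2to1.tr_eval_dom tr K'.main (trList [Encodable.encode e])).trans ?_
    have hinit : (TM2.init K'.main (trList [Encodable.encode e]) :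
        TM2.Cfg (fun _ : K' => Γ') Λ' (Option Γ')) = init c [Encodable.encode e] := by
      simp only [TM2.init, init]
      congr 1
      funext k
      cases k <;> rfl
    have hcode := hc ⟨[Encodable.encode e], rfl⟩
    change (StateTransition.eval (TM2.step tr) _).Dom ↔ _
    rw [hinit, PartrecToTM2.tr_eval]
    change (c.eval [Encodable.encode e]).Dom ↔ _
    rw [hcode]
    change ((Denumerable.ofNat Nat.Partrec.Code (Encodable.encode e)).eval 0).Dom ↔ _
    rw [Denumerable.ofNat_encode]

end Halting

/-- Every one-way deterministic automaton is an automaton of each of the four types. -/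
theorem LanguageFamily.EffectivelyContains.oneWayDFA {k : ℕ} {α : Type*} [Primcodable α]
    {E : LanguageFamily α} (h : E.EffectivelyContains (MultiHeadAutomaton.oneWayDFA k) ∨
      E.EffectivelyContains (MultiHeadAutomaton.oneWayNFA k) ∨
      E.EffectivelyContains (MultiHeadAutomaton.twoWayDFA k) ∨
      E.EffectivelyContains (MultiHeadAutomaton.twoWayNFA k)) :
    E.EffectivelyContains (MultiHeadAutomaton.oneWayDFA k) := by
  rcases h with h | ⟨g, hg, h⟩ | ⟨g, hg, h⟩ | ⟨g, hg, h⟩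
  · exact h
  · exact ⟨g, hg, fun D hD => h D ⟨hD.1, hD.2.1⟩⟩
  · exact ⟨g, hg, fun D hD => h D ⟨hD.1, hD.2.2⟩⟩
  · exact ⟨g, hg, fun D hD => h D hD.1⟩

/-- The proof does not use `hword`: the reduction only queries the pumping constant, and the bounded
simulation that it calls for is always possible. -/
theorem mainTheorem7 (k : ℕ) (hk : 2 ≤ k) {α : Type*} [Primcodable α] (E : LanguageFamily α)
    (hword : E.SemiDecidableWordProblem)
    (hcontains : E.EffectivelyContains (MultiHeadAutomaton.oneWayDFA k) ∨
      E.EffectivelyContains (MultiHeadAutomaton.oneWayNFA k) ∨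
      E.EffectivelyContains (MultiHeadAutomaton.twoWayDFA k) ∨
      E.EffectivelyContains (MultiHeadAutomaton.twoWayNFA k)) :
    ¬ E.PossessesPumpingLemma := by
  intro hpump
  obtain ⟨Q, Γ, _, _, _, _, δ, q₀, u, hu, hdom⟩ := QueueMachine.exists_dom_iff_code_dom
  have h := QueueMachine.computablePred_dom_of_possessesPumpingLemma hk
    (LanguageFamily.EffectivelyContains.oneWayDFA hcontains) hpump δ q₀
  refine ComputablePred.halting_problem 0 ?_
  obtain ⟨f, hf, hfu⟩ := ComputablePred.computable_iff.1 h
  refine ComputablePred.computable_iff.2 ⟨fun e => f (u e), hf.comp hu, funext fun e => ?_⟩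
  rw [← hdom e]
  exact congrFun hfu (u e)
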